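/- Let $\mathfrak g$ be a finite-dimensional simple Lie algebra over $\mathbb C$ with a Cartan subalgebra $\mathfrak h$ and a triangular decomposition $\mathfrak g=\mathfrak n_-\oplus\mathfrak h\oplus\mathfrak n_+$ (given by a base of the root system), and let $(\cdot|\cdot)$ be its Killing form. Let $\hat{\mathfrak g}=\mathfrak g\otimes\mathbb C[t,t^{-1}]\oplus\mathbb C K$ be the Lie algebra in which $K$ is central and $$[x\otimes t^r,y\otimes t^s]=[x,y]\otimes t^{r+s}+(x|y)\,r\,\delta_{r+s,0}\,K\qquad(x,y\in\mathfrak g,\ r,s\in\mathbb Z).$$ Let $a=(a_1,\dots,a_m)\in\mathbb C^m$ have nonzero, pairwise distinct entries, let $\lambda=(\lambda_1,\dots,\lambda_m)\in(\mathfrak h^*)^m$, and let $V(\lambda_i)$ be the irreducible highest weight $\mathfrak g$-module with highest weight $\lambda_i$ (unique up to isomorphism, possibly infinite-dimensional). Let $E(\lambda,a)=V(\lambda_1)\otimes\cdots\otimes V(\lambda_m)$ be the $\hat{\mathfrak g}$-module on which $K$ acts by $0$ and $$(x\otimes t^k)(v_1\otimes\cdots\otimes v_m)=\sum_{i=1}^m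 a_i^k\, v_1\otimes\cdots\otimes xv_i\otimes\cdots\otimes v_m\qquad(x\in\mathfrak g,\ k\in\mathbb Z).$$ Let $L$ be a $\hat{\mathfrak g}$-module such that for every $v\in L$ we have $(\mathfrak g\otimes t^k\mathbb C[t])v=0$ for all sufficiently large $k\in\mathbb N$. Then every $\hat{\mathfrak g}$-submodule of $E(\lambda,a)\otimes L$ is of the form $E(\lambda,a)\otimes N$ for some $\hat{\mathfrak g}$-submodule $N$ of $L$. In particular, if $L$ is irreducible, then $E(\lambda,a)\otimes L$ is an irreducible $\hat{\mathfrak g}$-module. -/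

import Mathlib

open scoped TensorProduct

noncomputable section

/-! ### The untwisted affine Lie algebra `ĝ = 𝔤 ⊗ ℂ[t, t⁻¹] ⊕ ℂ K` -/

namespace AffineLie

open LieAlgebra

variable (𝔤 : Type*) [LieRing 𝔤] [LieAlgebra ℂ 𝔤]

theorem neg_killingForm_lieInvariant :
    LinearMap.BilinForm.lieInvariant 𝔤 (-(killingForm ℂ 𝔤)) := by
  intro x y z
  have h := LieModule.traceForm_lieInvariant ℂ 𝔤 𝔤 x y z
  simpa using congrArg Neg.neg h

theorem neg_killingForm_isSymm : LinearMap.BilinForm.IsSymm (-(killingForm ℂ 𝔤)) :=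
  ⟨fun x y => by simp [LieModule.traceForm_comm ℂ 𝔤 𝔤 x y]⟩

/-- The cocycle `(x ⊗ t^m, y ⊗ t^n) ↦ m δ_{m+n,0} (x|y)`, with `(·|·)` the Killing form.
Mathlib's cocycle attached to a form `Φ` is `(x ⊗ t^m, y ⊗ t^n) ↦ n δ_{m+n,0} Φ(x, y)`, which
explains the sign (see `lie_xt_xt` below for the resulting bracket). -/
def cocycle :=
  LoopAlgebra.twoCocycleOfBilinear ℂ ℤ 𝔤 (-(killingForm ℂ 𝔤))
    (neg_killingForm_lieInvariant 𝔤) (neg_killingForm_isSymm 𝔤)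

/-- The affine Lie algebra `ĝ`: the central extension of the loop algebra `𝔤 ⊗ ℂ[t, t⁻¹]`
by `ℂ K` (without the derivation `d`). -/
def Affine : Type _ := LieAlgebra.ofTwoCocycle (cocycle 𝔤)

instance : LieRing (Affine 𝔤) := inferInstanceAs (LieRing (LieAlgebra.ofTwoCocycle (cocycle 𝔤)))

instance : LieAlgebra ℂ (Affine 𝔤) :=
  inferInstanceAs (LieAlgebra ℂ (LieAlgebra.ofTwoCocycle (cocycle 𝔤)))

variable {𝔤}

/-- The element `x ⊗ t^n` of `ĝ`. -/
def xt (x : 𝔤) (n : ℤ) : Affine 𝔤 :=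
  LieAlgebra.ofProd (cocycle 𝔤) ((AddMonoidAlgebra.single n (1 : ℂ)) ⊗ₜ[ℂ] x, 0)

variable (𝔤) in
/-- The central element `K` of `ĝ`. -/
def K : Affine 𝔤 :=
  LieAlgebra.ofProd (cocycle 𝔤) (0, (TrivialLieModule.equiv ℂ (loopAlgebra ℂ ℤ 𝔤) ℂ).symm 1)

variable (𝔤) in
/-- The projection `ĝ → 𝔤 ⊗ ℂ[t, t⁻¹]` with kernel `ℂ K`. -/
def toLoop : Affine 𝔤 →ₗ⁅ℂ⁆ loopAlgebra ℂ ℤ 𝔤 where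
  toFun X := ((LieAlgebra.ofProd (cocycle 𝔤)).symm X).1
  map_add' _ _ := rfl
  map_smul' _ _ := rfl
  map_lie' := rfl

@[simp] theorem toLoop_xt (x : 𝔤) (n : ℤ) :
    toLoop 𝔤 (xt x n) = (AddMonoidAlgebra.single n (1 : ℂ)) ⊗ₜ[ℂ] x := rfl

@[simp] theorem toLoop_K : toLoop 𝔤 (K 𝔤) = 0 := rfl

/-- The defining bracket of `ĝ`. -/
theorem lie_xt_xt (x y : 𝔤) (m n : ℤ) :
    ⁅xt x m, xt y n⁆ =
      xt ⁅x, y⁆ (m + n) + (if m + n = 0 then (m : ℂ) * killingForm ℂ 𝔤 x y else 0) • K 𝔤 := by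
  refine congrArg (LieAlgebra.ofProd (cocycle 𝔤)) (Prod.ext ?_ ?_)
  · change ⁅AddMonoidAlgebra.single m (1 : ℂ) ⊗ₜ[ℂ] x, AddMonoidAlgebra.single n (1 : ℂ) ⊗ₜ[ℂ] y⁆ =
      AddMonoidAlgebra.single (m + n) (1 : ℂ) ⊗ₜ[ℂ] ⁅x, y⁆ + (_ : ℂ) • (0 : loopAlgebra ℂ ℤ 𝔤)
    rw [LieAlgebra.ExtendScalars.bracket_tmul, AddMonoidAlgebra.single_mul_single, smul_zero,
      add_zero, mul_one]
  · apply (TrivialLieModule.equiv ℂ (loopAlgebra ℂ ℤ 𝔤) ℂ).injective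
    change LoopAlgebra.residuePairing ℂ ℤ 𝔤 (-(killingForm ℂ 𝔤))
        (AddMonoidAlgebra.single m (1 : ℂ) ⊗ₜ[ℂ] x) (AddMonoidAlgebra.single n (1 : ℂ) ⊗ₜ[ℂ] y) +
        0 - 0 = 0 + (_ : ℂ) • (1 : ℂ)
    rw [LoopAlgebra.residuePairing_apply_apply, LoopAlgebra.toFinsupp_single_tmul,
      LoopAlgebra.toFinsupp_single_tmul, Finsupp.sum_single_index (by simp)]
    by_cases h : m + n = 0
    · obtain rfl : n = -m := by omega
      simp
    · rw [Finsupp.single_eq_of_ne (by omega)]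
      simp [h]

theorem lie_K (X : Affine 𝔤) : ⁅X, K 𝔤⁆ = 0 := by
  refine congrArg (LieAlgebra.ofProd (cocycle 𝔤)) (Prod.ext ?_ ?_)
  · simp [K]
  · simp [K, trivial_lie_zero]

variable (𝔤) in
/-- The subspace `𝔤 ⊗ t^k ℂ[t]` of `ĝ`. -/
def tail (k : ℕ) : Submodule ℂ (Affine 𝔤) :=
  Submodule.span ℂ {X | ∃ (x : 𝔤) (j : ℕ), k ≤ j ∧ X = xt x j}

/-! ### Evaluation modules -/

variable (𝔤) in
/-- Evaluation at `t = z` for `z ≠ 0`, as a homomorphism `𝔤 ⊗ ℂ[t, t⁻¹] → 𝔤`,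
`x ⊗ f ↦ f(z) x`. -/
def evalAt (z : ℂˣ) : loopAlgebra ℂ ℤ 𝔤 →ₗ⁅ℂ⁆ 𝔤 where
  toLinearMap := (TensorProduct.lid ℂ 𝔤).toLinearMap ∘ₗ LinearMap.rTensor 𝔤
    (AddMonoidAlgebra.lift ℂ ℂ ℤ ((Units.coeHom ℂ).comp (zpowersHom ℂˣ z))).toLinearMap
  map_lie' {x y} := by
    induction x using TensorProduct.induction_on with
    | zero => simp
    | add x₁ x₂ h₁ h₂ => simp_all [add_lie]
    | tmul f x =>
      induction y using TensorProduct.induction_on with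
      | zero => simp
      | add y₁ y₂ h₁ h₂ => simp_all [lie_add]
      | tmul g y => simp [LieAlgebra.ExtendScalars.bracket_tmul, smul_smul, mul_comm]

theorem evalAt_tmul (z : ℂˣ) (x : 𝔤) (n : ℤ) :
    evalAt 𝔤 z ((AddMonoidAlgebra.single n (1 : ℂ)) ⊗ₜ[ℂ] x) = ((z : ℂ) ^ n) • x := by
  change TensorProduct.lid ℂ 𝔤 (LinearMap.rTensor 𝔤
    (AddMonoidAlgebra.lift ℂ ℂ ℤ ((Units.coeHom ℂ).comp (zpowersHom ℂˣ z))).toLinearMap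
    ((AddMonoidAlgebra.single n (1 : ℂ)) ⊗ₜ[ℂ] x)) = _
  rw [LinearMap.rTensor_tmul, TensorProduct.lid_tmul, AlgHom.toLinearMap_apply,
    AddMonoidAlgebra.lift_single]
  simp

section Slot

variable {ι : Type*} [DecidableEq ι] (V : ι → Type*)
  [∀ i, AddCommGroup (V i)] [∀ i, Module ℂ (V i)]

variable {V} in
/-- The operator on `⨂ i, V i` that applies `f` in the tensor factor `i`:
`⊗ v_j ↦ v_1 ⊗ ⋯ ⊗ f v_i ⊗ ⋯ ⊗ v_m`. -/
def slot (i : ι) (f : Module.End ℂ (V i)) : Module.End ℂ (⨂[ℂ] i, V i) :=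
  PiTensorProduct.map (Function.update (fun j => (LinearMap.id : V j →ₗ[ℂ] V j)) i f)

variable {V} in
theorem slot_tprod (i : ι) (f : Module.End ℂ (V i)) (v : ∀ i, V i) :
    slot i f (PiTensorProduct.tprod ℂ v) =
      PiTensorProduct.tprod ℂ (Function.update v i (f (v i))) := by
  rw [slot, PiTensorProduct.map_tprod]
  congr 1
  funext j
  by_cases h : j = i
  · subst h; simp
  · simp [h]

variable {V} in
theorem slot_add (i : ι) (f g : Module.End ℂ (V i)) : slot i (f + g) = slot i f + slot i g :=
  PiTensorProduct.map_update_add _ _ _ _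

variable {V} in
theorem slot_smul (i : ι) (c : ℂ) (f : Module.End ℂ (V i)) : slot i (c • f) = c • slot i f :=
  PiTensorProduct.map_update_smul _ _ _ _

variable {V} in
theorem slot_lie (i : ι) (f g : Module.End ℂ (V i)) :
    slot i (f * g - g * f) = slot i f * slot i g - slot i g * slot i f := by
  have h : f * g = (f * g - g * f) + g * f := by abel
  have h₂ (p q : Module.End ℂ (V i)) : slot i (p * q) = slot i p * slot i q := by
    ext v
    simp [slot_tprod]
  rw [eq_sub_iff_add_eq, ← h₂, ← h₂, ← slot_add, ← h]

variable {V} in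
theorem slot_comm {i j : ι} (hij : i ≠ j) (f : Module.End ℂ (V i)) (g : Module.End ℂ (V j)) :
    slot i f * slot j g = slot j g * slot i f := by
  ext v
  simp [slot_tprod, hij, hij.symm, Function.update_comm hij]

variable [Fintype ι] [∀ i, LieRingModule 𝔤 (V i)] [∀ i, LieModule ℂ 𝔤 (V i)]

variable (𝔤) in
/-- The action of `ĝ` on `⨂ i, V i` through evaluation at the points `a i`:
`x ⊗ t^k` acts by `∑ i, (a i)^k (1 ⊗ ⋯ ⊗ x ⊗ ⋯ ⊗ 1)`, and `K` acts by `0`. -/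
def evalAction (a : ι → ℂˣ) : Affine 𝔤 →ₗ[ℂ] Module.End ℂ (⨂[ℂ] i, V i) where
  toFun X := ∑ i, slot i (LieModule.toEnd ℂ 𝔤 (V i) (evalAt 𝔤 (a i) (toLoop 𝔤 X)))
  map_add' X Y := by simp [slot_add, Finset.sum_add_distrib]
  map_smul' c X := by simp [slot_smul, Finset.smul_sum]

theorem evalAction_lie (a : ι → ℂˣ) (X Y : Affine 𝔤) :
    evalAction 𝔤 V a ⁅X, Y⁆ =
      evalAction 𝔤 V a X * evalAction 𝔤 V a Y - evalAction 𝔤 V a Y * evalAction 𝔤 V a X := by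
  simp only [evalAction, LinearMap.coe_mk, AddHom.coe_mk, Finset.sum_mul_sum]
  rw [Finset.sum_comm (γ := ι), ← Finset.sum_sub_distrib]
  refine Finset.sum_congr rfl fun i _ => ?_
  rw [← Finset.sum_sub_distrib, Finset.sum_eq_single i]
  · rw [← slot_lie, LieHom.map_lie, LieHom.map_lie]
    congr 1
    ext v
    simp
  · intro j _ hj
    rw [slot_comm hj, sub_self]
  · simp

/-- The vector space `⨂ i, V i` carrying the evaluation action of `ĝ` at the points `a i`. -/
def EvalModule (_a : ι → ℂˣ) : Type _ := ⨂[ℂ] i, V i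

variable (a : ι → ℂˣ)

instance : AddCommGroup (EvalModule V a) := inferInstanceAs (AddCommGroup (⨂[ℂ] i, V i))

instance : Module ℂ (EvalModule V a) := inferInstanceAs (Module ℂ (⨂[ℂ] i, V i))

instance : LieRingModule (Affine 𝔤) (EvalModule V a) where
  bracket X e := evalAction 𝔤 V a X e
  add_lie X Y e := by simp only [map_add]; rfl
  lie_add X := (evalAction 𝔤 V a X).map_add
  leibniz_lie X Y e := by
    have h := LinearMap.congr_fun (evalAction_lie V a X Y) e
    exact (eq_sub_iff_add_eq.mp h).symm

instance : LieModule ℂ (Affine 𝔤) (EvalModule V a) where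
  smul_lie c X e := LinearMap.congr_fun ((evalAction 𝔤 V a).map_smul c X) e
  lie_smul c X := (evalAction 𝔤 V a X).map_smul c

theorem lie_def (X : Affine 𝔤) (e : EvalModule V a) : ⁅X, e⁆ = evalAction 𝔤 V a X e := rfl

/-- The pure tensor `⊗ v_i` as an element of the evaluation module. -/
def EvalModule.pure (v : ∀ i, V i) : EvalModule V a := PiTensorProduct.tprod ℂ v

/-- The defining formula for the action on the evaluation module. -/
theorem xt_lie_pure (x : 𝔤) (k : ℤ) (v : ∀ i, V i) :
    ⁅xt x k, EvalModule.pure V a v⁆ =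
      ∑ i, ((a i : ℂ) ^ k) • EvalModule.pure V a (Function.update v i ⁅x, v i⁆) := by
  rw [lie_def]
  change (∑ i, slot i _) (PiTensorProduct.tprod ℂ v) = _
  rw [LinearMap.sum_apply]
  refine Finset.sum_congr rfl fun i _ => ?_
  rw [toLoop_xt, evalAt_tmul, map_smul, slot_smul, LinearMap.smul_apply, slot_tprod]
  rfl

theorem K_lie (e : EvalModule V a) : ⁅K 𝔤, e⁆ = 0 := by
  rw [lie_def]
  change (∑ i, slot i _) e = 0
  have h (i : ι) : slot i (0 : Module.End ℂ (V i)) = 0 := by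
    simpa using slot_smul i (0 : ℂ) (0 : Module.End ℂ (V i))
  simp only [toLoop_K, map_zero, h, Finset.sum_const_zero]
  rfl

end Slot

/-! ### Irreducible highest weight modules over `𝔤` -/

section HighestWeight

variable [FiniteDimensional ℂ 𝔤] [LieAlgebra.IsSimple ℂ 𝔤]
  {H : LieSubalgebra ℂ 𝔤} [H.IsCartanSubalgebra]

/-- `v` is a highest weight vector of weight `μ` for the Cartan subalgebra `H` and the positive
system given by the base `b` (so `𝔫₊` is the sum of the positive root spaces). -/
structure IsHighestWeightVector (b : (IsKilling.rootSystem H).Base) (μ : Module.Dual ℂ H)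
    {V : Type*} [AddCommGroup V] [Module ℂ V] [LieRingModule 𝔤 V] (v : V) : Prop where
  ne_zero : v ≠ 0
  weight : ∀ h : H, ⁅(h : 𝔤), v⁆ = μ h • v
  pos : ∀ α : H.root, b.IsPos α → ∀ x ∈ rootSpace H (α : LieModule.Weight ℂ H 𝔤), ⁅x, v⁆ = 0

/-- `V` is a realization of `V(μ)`, the irreducible highest weight `𝔤`-module with highest
weight `μ`: it is irreducible and generated by a highest weight vector of weight `μ`. -/
structure IsIrreducibleHighestWeight (b : (IsKilling.rootSystem H).Base) (μ : Module.Dual ℂ H)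
    (V : Type*) [AddCommGroup V] [Module ℂ V] [LieRingModule 𝔤 V] : Prop where
  irreducible : LieModule.IsIrreducible ℂ 𝔤 V
  generated : ∃ v : V, IsHighestWeightVector b μ v ∧ LieSubmodule.lieSpan ℂ 𝔤 {v} = ⊤

end HighestWeight

end AffineLie

end

-- Let `W` be a submodule of `E ⊗ L` and `w ∈ W`. For large `k`, `x ⊗ t^k` kills the finitely many
-- vectors of `L` occurring in `w`, so it acts on `w` as `∑ i, (a i)^k x_i`, where `x_i` is `x`
-- acting on the factor `V i`. As the `a i` are distinct and nonzero, interpolation puts every `x_i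
-- w` in `W` (`rTensor_slotAction_mem`). Each `V i` is irreducible of countable dimension, so by
-- Schur's lemma over the uncountable field `ℂ` its endomorphisms are scalars. Jacobson density then
-- makes every linear operator on `V i` agree, on any finite set of vectors, with an element of the
-- algebra generated by `𝔤` (`LieModule.exists_mem_adjoin_of_isIrreducible`). Hence `W` is stable
-- under all operators on the factors, in particular under matrix units of `E` for a product basis.
-- This forces `W = E ⊗ N` with `N = {l | E ⊗ l ⊆ W}`, which is `rightFactor W`.

universe u v w

/-! ### Nonempty spectrum in algebras of small dimension -/

section Spectrum

open Polynomial

variable {K : Type u} {A : Type v} [Field K] [IsAlgClosed K] [Ring A] [Algebra K A]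

theorem spectrum.isUnit_aeval_of_eq_empty {a : A} (ha : spectrum K a = ∅) {p : K[X]}
    (hp : p ≠ 0) : IsUnit (aeval a p) := by
  have h : IsUnit (aeval a (p.roots.map (fun x : K => X - C x)).prod) := by
    by_contra h
    obtain ⟨k, hk, -⟩ := spectrum.exists_mem_of_not_isUnit_aeval_prod h
    simp [ha] at hk
  rw [(IsAlgClosed.splits p).eq_prod_roots, map_mul, aeval_C]
  exact ((IsUnit.mk0 _ (leadingCoeff_ne_zero.mpr hp)).map (algebraMap K A)).mul h

/-- Resolvents of an element with empty spectrum are linearly independent. -/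
theorem spectrum.linearIndependent_resolvent [Nontrivial A] {a : A} (ha : spectrum K a = ∅)
    (r : K → A) (hr : ∀ c, (a - algebraMap K A c) * r c = 1) : LinearIndependent K r := by
  classical
  rw [linearIndependent_iff']
  intro s g hg i hi
  by_contra hgi
  -- The linear relation with denominators cleared: `p` kills `a`, yet `p(i) = g i * ∏ (i - j) ≠ 0`.
  set p : K[X] := ∑ c ∈ s, C (g c) * ∏ j ∈ s.erase c, (X - C j) with hp
  have hp0 : p ≠ 0 := by
    intro h0
    have h := congrArg (eval i) h0
    rw [hp, eval_finsetSum, Finset.sum_eq_single i] at h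
    · simp only [eval_mul, eval_C, eval_prod, eval_sub, eval_X, eval_zero, mul_eq_zero, hgi,
        false_or, Finset.prod_eq_zero_iff, sub_eq_zero] at h
      obtain ⟨j, hj, rfl⟩ := h
      simp at hj
    · intro c _ hci
      rw [eval_mul, eval_prod, Finset.prod_eq_zero (Finset.mem_erase.mpr ⟨hci.symm, hi⟩) (by simp),
        mul_zero]
    · exact fun h => absurd hi h
  have hmul (c : K) (hc : c ∈ s) :
      aeval a (∏ j ∈ s.erase c, (X - C j)) = aeval a (∏ j ∈ s, (X - C j)) * r c := by
    rw [← Finset.prod_erase_mul s _ hc, map_mul, mul_assoc]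
    simp [hr]
  have hpa : aeval a p = 0 := by
    rw [hp, map_sum]
    calc _ = ∑ c ∈ s, aeval a (∏ j ∈ s, (X - C j)) * (g c • r c) := by
          refine Finset.sum_congr rfl fun c hc => ?_
          rw [map_mul, hmul c hc, aeval_C, ← Algebra.smul_def, mul_smul_comm]
      _ = 0 := by rw [← Finset.mul_sum, hg, mul_zero]
  exact not_isUnit_zero (hpa ▸ spectrum.isUnit_aeval_of_eq_empty ha hp0)

/-- An empty spectrum would give an independent family of resolvents indexed by all of `K`. -/
theorem spectrum.nonempty_of_lift_rank_lt [Nontrivial A] (a : A)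
    (h : Cardinal.lift.{u} (Module.rank K A) < Cardinal.lift.{v} (Cardinal.mk K)) :
    (spectrum K a).Nonempty := by
  by_contra hne
  rw [Set.not_nonempty_iff_eq_empty] at hne
  have hu (c : K) : IsUnit (a - algebraMap K A c) := by
    have : c ∉ spectrum K a := by simp [hne]
    rw [spectrum.notMem_iff] at this
    rwa [← IsUnit.neg_iff, neg_sub]
  exact h.not_ge
    (spectrum.linearIndependent_resolvent hne (fun c => ↑(hu c).unit⁻¹)
      (fun c => (hu c).mul_val_inv)).cardinal_lift_le_rank

end Spectrum

/-! ### Schur's lemma and density -/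

section Schur

variable {K : Type u} {R : Type w} {V : Type v} [Field K] [IsAlgClosed K] [Ring R] [Algebra K R] [AddCommGroup V]
  [Module K V] [Module R V] [IsScalarTower K R V] [IsSimpleModule R V]

/-- Schur's lemma for simple modules of dimension less than the cardinality of the field. -/
theorem IsSimpleModule.exists_eq_smul_of_lift_rank_lt
    (h : Cardinal.lift.{u} (Module.rank K V) < Cardinal.lift.{v} (Cardinal.mk K))
    (φ : Module.End R V) : ∃ c : K, ∀ v, φ v = c • v := by
  classical
  have := IsSimpleModule.nontrivial R V
  obtain ⟨v, hv⟩ := exists_ne (0 : V)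
  -- Nonzero endomorphisms are injective, so evaluation at `v ≠ 0` embeds `Module.End R V` in `V`
  -- and bounds its dimension.
  let ev : Module.End R V →ₗ[K] V :=
    { toFun := fun φ => φ v, map_add' := fun _ _ => rfl, map_smul' := fun _ _ => rfl }
  have hev : Function.Injective ev := by
    rw [injective_iff_map_eq_zero]
    intro ψ hψ
    by_contra hne
    exact hv ((LinearMap.bijective_of_ne_zero hne).1 (hψ.trans (map_zero ψ).symm))
  obtain ⟨c, hc⟩ := spectrum.nonempty_of_lift_rank_lt (K := K) φ
    ((Cardinal.lift_le.mpr (LinearMap.rank_le_of_injective ev hev)).trans_lt h)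
  refine ⟨c, fun w => ?_⟩
  rw [spectrum.mem_iff, isUnit_iff_ne_zero, not_not, sub_eq_zero] at hc
  exact (congrArg (fun ψ : Module.End R V => ψ w) hc).symm

/-- Since `Module.End R V` consists of scalars, every `K`-linear map commutes with it, as Jacobson
density requires. -/
theorem IsSimpleModule.exists_smul_eq_of_lift_rank_lt
    (h : Cardinal.lift.{u} (Module.rank K V) < Cardinal.lift.{v} (Cardinal.mk K))
    (f : Module.End K V) (s : Finset V) : ∃ r : R, ∀ v ∈ s, f v = r • v := by
  let g : Module.End (Module.End R V) V :=
    { toFun := f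
      map_add' := f.map_add
      map_smul' := fun φ v => by
        obtain ⟨c, hc⟩ := IsSimpleModule.exists_eq_smul_of_lift_rank_lt (K := K) h φ
        simp [hc] }
  exact jacobson_density g s

end Schur

/-! ### Countable dimension -/

section Countable

theorem Submonoid.countable_closure {M : Type*} [Monoid M] {s : Set M} (hs : s.Countable) :
    (Submonoid.closure s : Set M).Countable := by
  have := hs.to_subtype
  rw [Submonoid.closure_eq_mrange, MonoidHom.coe_mrange]
  have : Countable (FreeMonoid s) := inferInstanceAs (Countable (List s))
  exact Set.countable_range _

theorem Algebra.rank_adjoin_le_aleph0 {K A : Type*} [Field K] [Ring A] [Algebra K A] {s : Set A}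
    (hs : s.Countable) : Module.rank K (Algebra.adjoin K s) ≤ Cardinal.aleph0 := by
  change Module.rank K (Subalgebra.toSubmodule (Algebra.adjoin K s)) ≤ _
  rw [Algebra.adjoin_eq_span]
  exact (rank_span_le _).trans (Cardinal.le_aleph0_iff_set_countable.mpr
    (Submonoid.countable_closure hs))

/-- A simple module is generated by any nonzero vector, hence is a quotient of `R`. -/
theorem IsSimpleModule.rank_le_aleph0 {K R V : Type*} [Field K] [Ring R] [Algebra K R]
    [AddCommGroup V] [Module K V] [Module R V] [IsScalarTower K R V] [IsSimpleModule R V]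
    (h : Module.rank K R ≤ Cardinal.aleph0) : Module.rank K V ≤ Cardinal.aleph0 := by
  have := IsSimpleModule.nontrivial R V
  obtain ⟨v, hv⟩ := exists_ne (0 : V)
  have := LinearMap.lift_rank_le_of_surjective
    ((LinearMap.toSpanSingleton R V v).restrictScalars K)
    (IsSimpleModule.toSpanSingleton_surjective R hv)
  have h' := this.trans (Cardinal.lift_le.mpr h)
  simpa using h'

end Countable

namespace LieModule

/-- The Jacobson density theorem for irreducible modules over a finite-dimensional Lie algebra. -/
theorem exists_mem_adjoin_of_isIrreducible {𝔤 : Type u} {V : Type v} [LieRing 𝔤] [LieAlgebra ℂ 𝔤]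
    [FiniteDimensional ℂ 𝔤] [AddCommGroup V] [Module ℂ V] [LieRingModule 𝔤 V] [LieModule ℂ 𝔤 V]
    [LieModule.IsIrreducible ℂ 𝔤 V] (f : Module.End ℂ V) (s : Finset V) :
    ∃ g ∈ Algebra.adjoin ℂ (Set.range (LieModule.toEnd ℂ 𝔤 V)), ∀ v ∈ s, f v = g v := by
  let B := Module.finBasis ℂ 𝔤
  -- A finite basis suffices to generate, and keeps `R` of countable dimension.
  let S : Set (Module.End ℂ V) := Set.range fun i => LieModule.toEnd ℂ 𝔤 V (B i)
  let R := Algebra.adjoin ℂ S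
  have hmem (x : 𝔤) : LieModule.toEnd ℂ 𝔤 V x ∈ R := by
    rw [← B.sum_repr x, map_sum]
    refine sum_mem fun i _ => ?_
    rw [map_smul]
    exact R.smul_mem (Algebra.subset_adjoin ⟨i, rfl⟩) _
  have : Nontrivial V := (LieSubmodule.nontrivial_iff ℂ 𝔤 V).mp inferInstance
  have : IsSimpleModule R V := by
    rw [isSimpleModule_iff]
    have : Nontrivial (Submodule R V) := (Submodule.nontrivial_iff R).mpr inferInstance
    refine { eq_bot_or_eq_top := fun p => ?_ }
    let N : LieSubmodule ℂ 𝔤 V :=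
      { p.restrictScalars ℂ with
        lie_mem := fun {x v} hv => p.smul_mem (⟨_, hmem x⟩ : R) hv }
    have hN (v : V) : v ∈ N ↔ v ∈ p := Iff.rfl
    rcases eq_bot_or_eq_top N with h | h
    · left
      ext v
      rw [← hN, h]
      simp
    · right
      ext v
      rw [← hN, h]
      simp
  have hrank : Cardinal.lift.{0} (Module.rank ℂ V) < Cardinal.lift.{v} (Cardinal.mk ℂ) := by
    have h := IsSimpleModule.rank_le_aleph0 (V := V)
      (Algebra.rank_adjoin_le_aleph0 (K := ℂ) (Set.countable_range _ : S.Countable))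
    rw [Cardinal.mk_complex, Cardinal.lift_continuum]
    refine lt_of_le_of_lt ?_ Cardinal.aleph0_lt_continuum
    simpa using h
  obtain ⟨r, hr⟩ := IsSimpleModule.exists_smul_eq_of_lift_rank_lt (R := R) hrank f s
  refine ⟨r, Algebra.adjoin_mono ?_ r.2, hr⟩
  rintro _ ⟨i, rfl⟩
  exact ⟨_, rfl⟩

end LieModule

/-! ### Subspaces of tensor products and interpolation -/

section Tensor

/-- Writing `w = ∑ B p ⊗ w_p`, the matrix unit sending `B p` to `B q` maps `w` to `B q ⊗ w_p`; so
each coefficient `w_p` lies in `N`. -/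
theorem TensorProduct.eq_range_lTensor_of_smulRight_mem {K E L ι : Type*} [Field K]
    [AddCommGroup E] [Module K E] [AddCommGroup L] [Module K L] (B : Module.Basis ι K E)
    (W : Submodule K (E ⊗[K] L)) (N : Submodule K L) (hN : ∀ l, l ∈ N ↔ ∀ e : E, e ⊗ₜ[K] l ∈ W)
    (hW : ∀ p q, ∀ w ∈ W, LinearMap.rTensor L ((B.coord p).smulRight (B q)) w ∈ W) :
    W = LinearMap.range (LinearMap.lTensor E N.subtype) := by
  classical
  apply le_antisymm
  · intro w hw
    rw [← (TensorProduct.equivFinsuppOfBasisLeft B).symm_apply_apply w,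
      TensorProduct.equivFinsuppOfBasisLeft_symm_apply, Finsupp.sum]
    refine sum_mem fun p hp => ?_
    have hN' : TensorProduct.equivFinsuppOfBasisLeft B w p ∈ N := by
      rw [hN]
      intro e
      have h (q : ι) : B q ⊗ₜ[K] TensorProduct.equivFinsuppOfBasisLeft B w p ∈ W := by
        convert hW p q w hw using 1
        clear hw hp
        induction w using TensorProduct.induction_on with
        | zero => simp
        | add x y hx hy => simp [TensorProduct.tmul_add, hx, hy]
        | tmul x y => simp [TensorProduct.smul_tmul]
      rw [← B.linearCombination_repr e, Finsupp.linearCombination_apply, Finsupp.sum,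
        TensorProduct.sum_tmul]
      exact sum_mem fun q _ => W.smul_mem _ (h q)
    exact ⟨B p ⊗ₜ ⟨_, hN'⟩, by simp⟩
  · rintro _ ⟨w, rfl⟩
    induction w using TensorProduct.induction_on with
    | zero => simp
    | add x y hx hy => rw [map_add]; exact add_mem hx hy
    | tmul x y => exact (hN _).mp y.2 x

/-- If all the combinations `∑ i, (a i) ^ k • u i` with `k` large lie in a subspace, where the
`a i` are nonzero and distinct, then so do the `u i`. -/
theorem Submodule.mem_of_sum_pow_smul_mem {K M ι : Type*} [Field K] [AddCommGroup M] [Module K M]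
    [Fintype ι] (W : Submodule K M) {a : ι → Kˣ} (ha : Function.Injective a) (u : ι → M) (k₀ : ℕ)
    (h : ∀ k ≥ k₀, ∑ i, ((a i : K) ^ k) • u i ∈ W) (i : ι) : u i ∈ W := by
  classical
  have hpoly (p : Polynomial K) : ∑ i, ((a i : K) ^ k₀ * p.eval (a i : K)) • u i ∈ W := by
    induction p using Polynomial.induction_on' with
    | add p q hp hq =>
      simp only [Polynomial.eval_add, mul_add, add_smul, Finset.sum_add_distrib]
      exact add_mem hp hq
    | monomial n c =>
      convert W.smul_mem c (h (k₀ + n) (by omega)) using 1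
      rw [Finset.smul_sum]
      refine Finset.sum_congr rfl fun i _ => ?_
      rw [smul_smul, Polynomial.eval_monomial]
      congr 1
      ring
  have ha' : Set.InjOn (fun i => (a i : K)) (Finset.univ : Finset ι) :=
    fun i _ j _ hij => ha (Units.ext hij)
  -- This polynomial is 1 at `a i` and 0 at the other points, leaving the invertible factor `(a
  -- i)^k₀`.
  have hi := hpoly (Lagrange.basis Finset.univ (fun i => (a i : K)) i)
  rw [Finset.sum_eq_single i, Lagrange.eval_basis_self ha' (Finset.mem_univ i), mul_one] at hi
  · exact (W.smul_mem_iff (pow_ne_zero _ (a i).ne_zero)).mp hi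
  · intro j _ hj
    rw [Lagrange.eval_basis_of_ne (v := fun i => (a i : K)) hj.symm (Finset.mem_univ j), mul_zero,
      zero_smul]
  · simp

end Tensor

/-! ### Operators on the factors of `⨂ i, V i` -/

noncomputable section

namespace AffineLie

section PiTensor

variable {ι : Type*} [Fintype ι] {V : ι → Type*}
  [∀ i, AddCommGroup (V i)] [∀ i, Module ℂ (V i)]

/-- A subspace of `(⨂ i, V i) ⊗ L` stable under all operators on the factors `V i` comes from a
subspace of `L`. -/
theorem eq_range_lTensor_of_rTensor_map_mem {L : Type*} [AddCommGroup L] [Module ℂ L]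
    (W : Submodule ℂ ((⨂[ℂ] i, V i) ⊗[ℂ] L))
    (hW : ∀ (f : ∀ i, Module.End ℂ (V i)), ∀ w ∈ W,
      LinearMap.rTensor L (PiTensorProduct.map f) w ∈ W)
    (N : Submodule ℂ L) (hN : ∀ l, l ∈ N ↔ ∀ e : ⨂[ℂ] i, V i, e ⊗ₜ[ℂ] l ∈ W) :
    W = LinearMap.range (LinearMap.lTensor (⨂[ℂ] i, V i) N.subtype) := by
  let b (i : ι) := Module.Basis.ofVectorSpace ℂ (V i)
  refine TensorProduct.eq_range_lTensor_of_smulRight_mem (Basis.piTensorProduct b) W N hN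
    fun p q w hw => ?_
  -- A matrix unit for the product basis is the tensor product of matrix units of the factors.
  convert hW (fun i => ((b i).coord (p i)).smulRight (b i (q i))) w hw using 2
  congr 1
  ext v
  simp only [LinearMap.compMultilinearMap_apply, PiTensorProduct.map_tprod,
    LinearMap.smulRight_apply, Module.Basis.coord_apply, Basis.piTensorProduct_repr_tprod_apply,
    Basis.piTensorProduct_apply]
  exact ((PiTensorProduct.tprod ℂ).map_smul_univ _ _).symm

theorem nontrivial_evalModule [∀ i, Nontrivial (V i)] (a : ι → ℂˣ) : Nontrivial (EvalModule V a) := by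
  let b (i : ι) := Module.Basis.ofVectorSpace ℂ (V i)
  have (i : ι) := (b i).index_nonempty
  exact ⟨_, 0, (Basis.piTensorProduct b).ne_zero (Classical.arbitrary _)⟩

end PiTensor

section SlotTensor

variable {ι : Type*} [DecidableEq ι] {V : ι → Type*}
  [∀ i, AddCommGroup (V i)] [∀ i, Module ℂ (V i)] {L : Type*} [AddCommGroup L] [Module ℂ L]

theorem slot_mul (i : ι) (f g : Module.End ℂ (V i)) : slot i (f * g) = slot i f * slot i g := by
  ext v
  simp [slot_tprod]

theorem slot_one (i : ι) : slot i (1 : Module.End ℂ (V i)) = 1 := by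
  ext v
  simp [slot_tprod]

theorem rTensor_slot_mem_of_mem_adjoin {W : Submodule ℂ ((⨂[ℂ] i, V i) ⊗[ℂ] L)} {i : ι}
    {s : Set (Module.End ℂ (V i))}
    (hs : ∀ f ∈ s, ∀ w ∈ W, LinearMap.rTensor L (slot i f) w ∈ W)
    {f : Module.End ℂ (V i)} (hf : f ∈ Algebra.adjoin ℂ s) :
    ∀ w ∈ W, LinearMap.rTensor L (slot i f) w ∈ W := by
  induction hf using Algebra.adjoin_induction with
  | mem f hf => exact hs f hf
  | algebraMap c =>
    intro w hw
    rw [Algebra.algebraMap_eq_smul_one, slot_smul, slot_one, LinearMap.rTensor_smul]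
    exact W.smul_mem c (by rwa [Module.End.one_eq_id, LinearMap.rTensor_id])
  | add f g _ _ hf hg =>
    intro w hw
    rw [slot_add, LinearMap.rTensor_add]
    exact add_mem (hf w hw) (hg w hw)
  | mul f g _ _ hf hg =>
    intro w hw
    rw [slot_mul, LinearMap.rTensor_mul]
    exact hf _ (hg w hw)

/-- The operator of `f` in the factor `i` depends, on a given tensor, only on the values of `f` at
finitely many vectors. -/
theorem exists_finset_rTensor_slot_eq (i : ι) (w : (⨂[ℂ] i, V i) ⊗[ℂ] L) :
    ∃ s : Finset (V i), ∀ f g : Module.End ℂ (V i), (∀ v ∈ s, f v = g v) →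
      LinearMap.rTensor L (slot i f) w = LinearMap.rTensor L (slot i g) w := by
  classical
  have key (e : ⨂[ℂ] i, V i) : ∃ s : Finset (V i), ∀ f g : Module.End ℂ (V i),
      (∀ v ∈ s, f v = g v) → slot i f e = slot i g e := by
    induction e using PiTensorProduct.induction_on with
    | smul_tprod c v =>
      refine ⟨{v i}, fun f g h => ?_⟩
      rw [map_smul, map_smul, slot_tprod, slot_tprod, h _ (Finset.mem_singleton_self _)]
    | add x y hx hy =>
      obtain ⟨s, hs⟩ := hx
      obtain ⟨t, ht⟩ := hy
      refine ⟨s ∪ t, fun f g h => ?_⟩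
      rw [map_add, map_add, hs f g fun v hv => h v (Finset.mem_union_left _ hv),
        ht f g fun v hv => h v (Finset.mem_union_right _ hv)]
  induction w using TensorProduct.induction_on with
  | zero => exact ⟨∅, by simp⟩
  | tmul e l =>
    obtain ⟨s, hs⟩ := key e
    exact ⟨s, fun f g h => by simp [hs f g h]⟩
  | add x y hx hy =>
    obtain ⟨s, hs⟩ := hx
    obtain ⟨t, ht⟩ := hy
    refine ⟨s ∪ t, fun f g h => ?_⟩
    rw [map_add, map_add, hs f g fun v hv => h v (Finset.mem_union_left _ hv),
      ht f g fun v hv => h v (Finset.mem_union_right _ hv)]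

/-- `PiTensorProduct.map f` is the product of the operators `slot i (f i)`, built up one index at a
time. -/
theorem rTensor_map_mem [Fintype ι] {W : Submodule ℂ ((⨂[ℂ] i, V i) ⊗[ℂ] L)}
    (hW : ∀ i (f : Module.End ℂ (V i)), ∀ w ∈ W, LinearMap.rTensor L (slot i f) w ∈ W)
    (f : ∀ i, Module.End ℂ (V i)) {w : (⨂[ℂ] i, V i) ⊗[ℂ] L} (hw : w ∈ W) :
    LinearMap.rTensor L (PiTensorProduct.map f) w ∈ W := by
  have key (s : Finset ι) :
      LinearMap.rTensor L (PiTensorProduct.map (s.piecewise f fun _ => LinearMap.id)) w ∈ W := by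
    induction s using Finset.induction_on with
    | empty => simpa using hw
    | insert i s hi ih =>
      have h : PiTensorProduct.map ((insert i s).piecewise f fun _ => LinearMap.id) =
          slot i (f i) * PiTensorProduct.map (s.piecewise f fun _ => LinearMap.id) := by
        ext v
        simp only [LinearMap.compMultilinearMap_apply, PiTensorProduct.map_tprod,
          Module.End.mul_apply, slot_tprod]
        congr 1
        funext j
        by_cases hj : j = i
        · subst hj
          simp [hi]
        · simp [hj]
      rw [h, LinearMap.rTensor_mul]
      exact hW i _ _ ih
  simpa using key Finset.univ

theorem rTensor_map_mem_of_isIrreducible [Fintype ι] {𝔤 : Type*} [LieRing 𝔤] [LieAlgebra ℂ 𝔤]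
    [FiniteDimensional ℂ 𝔤] [∀ i, LieRingModule 𝔤 (V i)] [∀ i, LieModule ℂ 𝔤 (V i)]
    [∀ i, LieModule.IsIrreducible ℂ 𝔤 (V i)] {W : Submodule ℂ ((⨂[ℂ] i, V i) ⊗[ℂ] L)}
    (hW : ∀ i (x : 𝔤), ∀ w ∈ W,
      LinearMap.rTensor L (slot i (LieModule.toEnd ℂ 𝔤 (V i) x)) w ∈ W)
    (f : ∀ i, Module.End ℂ (V i)) {w : (⨂[ℂ] i, V i) ⊗[ℂ] L} (hw : w ∈ W) :
    LinearMap.rTensor L (PiTensorProduct.map f) w ∈ W := by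
  refine rTensor_map_mem (fun i f w hw => ?_) f hw
  obtain ⟨s, hs⟩ := exists_finset_rTensor_slot_eq i w
  obtain ⟨g, hg, hfg⟩ := LieModule.exists_mem_adjoin_of_isIrreducible (𝔤 := 𝔤) f s
  rw [hs f g hfg]
  refine rTensor_slot_mem_of_mem_adjoin ?_ hg w hw
  rintro _ ⟨x, rfl⟩
  exact hW i x

end SlotTensor

/-! ### Submodules of `E ⊗ L` -/

variable {𝔤 : Type*} [LieRing 𝔤] [LieAlgebra ℂ 𝔤] {ι : Type*} [DecidableEq ι] [Fintype ι]
  {V : ι → Type*} [∀ i, AddCommGroup (V i)] [∀ i, Module ℂ (V i)]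
  [∀ i, LieRingModule 𝔤 (V i)] [∀ i, LieModule ℂ 𝔤 (V i)] {a : ι → ℂˣ}
  {L : Type*} [AddCommGroup L] [Module ℂ L] [LieRingModule (Affine 𝔤) L]
  [LieModule ℂ (Affine 𝔤) L]

variable (V a) in
/-- The action of `x : 𝔤` on the tensor factor `i` of the evaluation module. -/
def slotAction (i : ι) (x : 𝔤) : Module.End ℂ (EvalModule V a) :=
  slot i (LieModule.toEnd ℂ 𝔤 (V i) x)

theorem xt_lie (x : 𝔤) (k : ℤ) (e : EvalModule V a) :
    ⁅xt x k, e⁆ = ∑ i, ((a i : ℂ) ^ k) • slotAction V a i x e := by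
  have h (e : ⨂[ℂ] i, V i) : evalAction 𝔤 V a (xt x k) e =
      ∑ i, ((a i : ℂ) ^ k) • slot i (LieModule.toEnd ℂ 𝔤 (V i) x) e := by
    refine (LinearMap.sum_apply Finset.univ _ e).trans (Finset.sum_congr rfl fun i _ => ?_)
    rw [toLoop_xt, evalAt_tmul, map_smul, slot_smul, LinearMap.smul_apply]
  exact h e

/-- In the Leibniz rule the term acting on `L` vanishes once `k` is large, with a bound independent
of `x`. -/
theorem exists_forall_ge_xt_lie
    (hL : ∀ v : L, ∃ k₀ : ℕ, ∀ k ≥ k₀, ∀ X ∈ tail 𝔤 k, ⁅X, v⁆ = 0) (w : EvalModule V a ⊗[ℂ] L) :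
    ∃ k₀ : ℕ, ∀ k ≥ k₀, ∀ x : 𝔤, ⁅xt x (k : ℤ), w⁆ =
      ∑ i, ((a i : ℂ) ^ k) • LinearMap.rTensor L (slotAction V a i x) w := by
  induction w using TensorProduct.induction_on with
  | zero => exact ⟨0, fun k _ x => by rw [lie_zero]; simp only [map_zero, smul_zero,
      Finset.sum_const_zero]⟩
  | tmul e l =>
    obtain ⟨k₀, hk₀⟩ := hL l
    refine ⟨k₀, fun k hk x => ?_⟩
    have h0 : ⁅xt x (k : ℤ), l⁆ = 0 :=
      hk₀ k hk _ (Submodule.subset_span ⟨x, k, le_rfl, rfl⟩)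
    rw [TensorProduct.LieModule.lie_tmul_right, h0, TensorProduct.tmul_zero, add_zero, xt_lie,
      TensorProduct.sum_tmul]
    refine Finset.sum_congr rfl fun i _ => ?_
    rw [← TensorProduct.smul_tmul', zpow_natCast]
    rfl
  | add y z hy hz =>
    obtain ⟨k₁, h₁⟩ := hy
    obtain ⟨k₂, h₂⟩ := hz
    refine ⟨max k₁ k₂, fun k hk x => ?_⟩
    rw [lie_add, h₁ k (le_of_max_le_left hk), h₂ k (le_of_max_le_right hk),
      ← Finset.sum_add_distrib]
    exact Finset.sum_congr rfl fun i _ => by rw [map_add, smul_add]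

theorem rTensor_slotAction_mem (ha : Function.Injective a)
    (hL : ∀ v : L, ∃ k₀ : ℕ, ∀ k ≥ k₀, ∀ X ∈ tail 𝔤 k, ⁅X, v⁆ = 0)
    (W : LieSubmodule ℂ (Affine 𝔤) (EvalModule V a ⊗[ℂ] L)) (i : ι) (x : 𝔤)
    {w : EvalModule V a ⊗[ℂ] L} (hw : w ∈ W) :
    LinearMap.rTensor L (slotAction V a i x) w ∈ W.toSubmodule := by
  obtain ⟨k₀, h⟩ := exists_forall_ge_xt_lie hL w
  exact W.toSubmodule.mem_of_sum_pow_smul_mem ha (fun i =>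
    LinearMap.rTensor L (slotAction V a i x) w) k₀
    (fun k hk => (h k hk x) ▸ W.lie_mem hw) i

/-- The largest submodule `N` of `L` with `E ⊗ N ⊆ W`. -/
def rightFactor {𝔞 E M : Type*} [LieRing 𝔞] [LieAlgebra ℂ 𝔞] [AddCommGroup E] [Module ℂ E]
    [LieRingModule 𝔞 E] [LieModule ℂ 𝔞 E] [AddCommGroup M] [Module ℂ M] [LieRingModule 𝔞 M]
    [LieModule ℂ 𝔞 M] (W : LieSubmodule ℂ 𝔞 (E ⊗[ℂ] M)) : LieSubmodule ℂ 𝔞 M where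
  carrier := {l | ∀ e : E, e ⊗ₜ[ℂ] l ∈ W}
  add_mem' hx hy e := by
    rw [TensorProduct.tmul_add]
    exact add_mem (hx e) (hy e)
  zero_mem' e := by
    rw [TensorProduct.tmul_zero]
    exact zero_mem W
  smul_mem' c l hl e := by
    rw [TensorProduct.tmul_smul]
    exact W.smul_mem c (hl e)
  lie_mem {X l} hl e := by
    -- `e ⊗ Xl = X(e ⊗ l) - Xe ⊗ l`, and both terms on the right lie in `W`.
    have h := W.lie_mem (x := X) (hl e)
    rw [TensorProduct.LieModule.lie_tmul_right] at h
    exact (add_mem_cancel_left (hl _)).mp h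

theorem toSubmodule_eq_range_lTensor_rightFactor [FiniteDimensional ℂ 𝔤]
    [∀ i, LieModule.IsIrreducible ℂ 𝔤 (V i)] (ha : Function.Injective a)
    (hL : ∀ v : L, ∃ k₀ : ℕ, ∀ k ≥ k₀, ∀ X ∈ tail 𝔤 k, ⁅X, v⁆ = 0)
    (W : LieSubmodule ℂ (Affine 𝔤) (EvalModule V a ⊗[ℂ] L)) :
    W.toSubmodule = LinearMap.range
      (LinearMap.lTensor (EvalModule V a) (rightFactor W).toSubmodule.subtype) :=
  eq_range_lTensor_of_rTensor_map_mem (V := V) W.toSubmodule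
    (fun f _ hw => rTensor_map_mem_of_isIrreducible (𝔤 := 𝔤)
      (fun i x _ hw => rTensor_slotAction_mem ha hL W i x hw) f hw)
    (rightFactor W).toSubmodule fun _ => Iff.rfl

end AffineLie

end

open AffineLie in
theorem theorem3p3 {𝔤 : Type*} [LieRing 𝔤] [LieAlgebra ℂ 𝔤] [FiniteDimensional ℂ 𝔤]
    [LieAlgebra.IsSimple ℂ 𝔤]
    (H : LieSubalgebra ℂ 𝔤) [H.IsCartanSubalgebra]
    (b : (LieAlgebra.IsKilling.rootSystem H).Base)
    (m : ℕ) (a : Fin m → ℂˣ) (ha : Function.Injective a)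
    (lam : Fin m → Module.Dual ℂ H)
    (V : Fin m → Type*) [∀ i, AddCommGroup (V i)] [∀ i, Module ℂ (V i)]
    [∀ i, LieRingModule 𝔤 (V i)] [∀ i, LieModule ℂ 𝔤 (V i)]
    (hV : ∀ i, IsIrreducibleHighestWeight b (lam i) (V i))
    (L : Type*) [AddCommGroup L] [Module ℂ L] [LieRingModule (Affine 𝔤) L]
    [LieModule ℂ (Affine 𝔤) L]
    (hL : ∀ v : L, ∃ k₀ : ℕ, ∀ k ≥ k₀, ∀ X ∈ tail 𝔤 k, ⁅X, v⁆ = 0) :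
    (∀ W : LieSubmodule ℂ (Affine 𝔤) (EvalModule V a ⊗[ℂ] L),
      ∃ N : LieSubmodule ℂ (Affine 𝔤) L,
        W.toSubmodule =
          LinearMap.range (LinearMap.lTensor (EvalModule V a) N.toSubmodule.subtype)) ∧
    (LieModule.IsIrreducible ℂ (Affine 𝔤) L →
      LieModule.IsIrreducible ℂ (Affine 𝔤) (EvalModule V a ⊗[ℂ] L)) := by
  have (i : Fin m) : LieModule.IsIrreducible ℂ 𝔤 (V i) := (hV i).irreducible
  have hW := toSubmodule_eq_range_lTensor_rightFactor (𝔤 := 𝔤) (V := V) ha hL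
  refine ⟨fun W => ⟨_, hW W⟩, fun hirr => ?_⟩
  -- Irreducibility includes `E ⊗ L ≠ 0`, which is derived from the factors.
  have (i : Fin m) : Nontrivial (V i) := (LieSubmodule.nontrivial_iff ℂ 𝔤 (V i)).mp inferInstance
  have : Nontrivial L := (LieSubmodule.nontrivial_iff ℂ (Affine 𝔤) L).mp inferInstance
  have : Nontrivial (EvalModule V a) := nontrivial_evalModule a
  have : Nontrivial (EvalModule V a ⊗[ℂ] L) := inferInstance
  refine LieModule.IsIrreducible.mk fun W hne => ?_
  have h := hW W
  rcases eq_bot_or_eq_top (rightFactor W) with hN | hN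
  · refine absurd ?_ hne
    rw [← LieSubmodule.toSubmodule_eq_bot, h, LinearMap.range_eq_bot]
    ext e ⟨l, hl⟩
    have : l = 0 := by simpa [hN] using hl
    simp [this]
  · rw [← LieSubmodule.toSubmodule_eq_top, h, LinearMap.range_eq_top]
    refine LinearMap.lTensor_surjective _ fun l => ⟨⟨l, ?_⟩, rfl⟩
    simp [hN]
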